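/- Let $\mathcal{X}$ be a finite set with at least two elements, let $W$ be the transition matrix of a time-homogeneous, irreducible Markov chain on $\mathcal{X}$, and let $Q_X$ be its (unique) stationary distribution; assume that the chain is reversible, i.e. $Q_X(x)\,W_{x,y} = Q_X(y)\,W_{y,x}$ for all $x,y\in\mathcal{X}$. Write $Q_{\min}$ for the minimal positive mass of $Q_X$ and $PW$ for the distribution $y \mapsto \sum_x P(x) W_{x,y}$. Fix a base larger than $1$ for the logarithm $\log$. For a convex $f\colon(0,\infty)\to\mathbb{R}$ with $f(1)=0$ and probability mass functions $P,Q$ on $\mathcal{X}$, let $D_f(P\|Q)=\sum_x Q(x) f\bigl(P(x)/Q(x)\bigr)$, with the conventions $f(0)=\lim_{t\to0^+}f(t)$, $0f(0/0)=0$ and $0f(a/0)=a\lim_{u\to\infty}f(u)/u$ for $a>0$; and for a stochastic matrix $V$ let $$\mu_f(Q_X,V)=\sup_{P:\,0<D_f(P\|Q_X)<\infty}\frac{D_f(PV\|Q_XV)}{D_f(P\|Q_X)} .$$ Let $D$ denote the relative entropy ($f(t)=t\log t$) and $\mu_{\chi^2}$ the contraction coefficient for $f(t)=(t-1)^2$.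 For $\alpha\in(0,1]$ put $$K_\alpha(P\|Q)=D\bigl(P\,\|\,(1-\alpha)P+\alpha Q\bigr),\qquad S_\alpha(P\|Q)=\alpha D\bigl(P\,\|\,(1-\alpha)P+\alpha Q\bigr)+(1-\alpha)D\bigl(Q\,\|\,(1-\alpha)P+\alpha Q\bigr),$$ $$k_\alpha(t)=t\log t-t\log\bigl(\alpha+(1-\alpha)t\bigr),\qquad s_\alpha(t)=\alpha t\log t-(\alpha t+1-\alpha)\log\bigl(\alpha+(1-\alpha)t\bigr).$$ Then, for all $\alpha\in(0,1]$, all integers $n\ge 0$ and every initial distribution $P_X$ on $\mathcal{X}$, $$K_\alpha(P_XW^n\|Q_X)\le\mu_{k_\alpha}(Q_X,W^n)\,K_\alpha(P_X\|Q_X),\qquad S_\alpha(P_XW^n\|Q_X)\le\mu_{s_\alpha}(Q_X,W^n)\,S_\alpha(P_X\|Q_X),$$ and $$\bigl(\mu_{\chi^2}(Q_X,W)\bigr)^n\le\mu_{k_\alpha}(Q_X,W^n)\le\frac{1}{\alpha\,Q_{\min}}\bigl(\mu_{\chi^2}(Q_X,W)\bigr)^n,$$ $$\bigl(\mu_{\chi^2}(Q_X,W)\bigr)^n\le\mu_{s_\alpha}(Q_X,W^n)\le\frac{(1-\alpha)\log_{\mathrm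 e}(1/\alpha)+2\alpha-1}{(1-3\alpha+3\alpha^2)\,Q_{\min}}\bigl(\mu_{\chi^2}(Q_X,W)\bigr)^n .$$ -/

import Mathlib

open Filter Topology Matrix

noncomputable section

namespace SkewDivergence

/-- One summand `q f(p/q)` of an `f`-divergence, for masses `p, q ≥ 0` and a function `f` on
`(0, ∞)`, with the usual conventions `f(0) := lim_{t → 0+} f(t)`, `0 f(0/0) := 0` and
`0 f(a/0) := a lim_{u → ∞} f(u)/u` for `a > 0` (limits in the extended reals). -/
def fDivTerm (f : ℝ → ℝ) (p q : ℝ) : EReal :=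
  if 0 < q then
    if 0 < p then ((q * f (p / q) : ℝ) : EReal)
    else (q : EReal) * limUnder (𝓝[>] (0 : ℝ)) (fun t : ℝ => (f t : EReal))
  else
    if 0 < p then (p : EReal) * limUnder atTop (fun u : ℝ => ((f u / u : ℝ) : EReal))
    else 0

/-- The `f`-divergence `D_f(P‖Q)` between probability mass functions on a finite set. -/
def fDiv {X : Type*} [Fintype X] (f : ℝ → ℝ) (P Q : X → ℝ) : EReal :=
  ∑ x, fDivTerm f (P x) (Q x)

/-- The function `t log_b t`, generator of the relative entropy. -/
def klFun (b : ℝ) (t : ℝ) : ℝ := t * Real.logb b t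

/-- The function `(t - 1)²`, generator of the chi-squared divergence. -/
def chiSqFun (t : ℝ) : ℝ := (t - 1) ^ 2

/-- The function `k_α`. -/
def kFun (b α : ℝ) (t : ℝ) : ℝ :=
  t * Real.logb b t - t * Real.logb b (α + (1 - α) * t)

/-- The function `s_α`. -/
def sFun (b α : ℝ) (t : ℝ) : ℝ :=
  α * t * Real.logb b t - (α * t + 1 - α) * Real.logb b (α + (1 - α) * t)

/-- The relative entropy `D(P‖Q)`, with logarithms to the base `b`. -/
def relEntropy {X : Type*} [Fintype X] (b : ℝ) (P Q : X → ℝ) : EReal :=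
  fDiv (klFun b) P Q

/-- The `α`-skew `K`-divergence `K_α(P‖Q) = D(P ‖ (1-α)P + αQ)`. -/
def skewK {X : Type*} [Fintype X] (b α : ℝ) (P Q : X → ℝ) : EReal :=
  relEntropy b P ((1 - α) • P + α • Q)

/-- The divergence `S_α(P‖Q) = α D(P ‖ (1-α)P + αQ) + (1-α) D(Q ‖ (1-α)P + αQ)`. -/
def skewS {X : Type*} [Fintype X] (b α : ℝ) (P Q : X → ℝ) : EReal :=
  (α : EReal) * relEntropy b P ((1 - α) • P + α • Q)
    + ((1 - α : ℝ) : EReal) * relEntropy b Q ((1 - α) • P + α • Q)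

/-- The contraction coefficient `μ_f(Q, W)` of the input distribution `Q` and the channel `W`:
the supremum of `D_f(PW‖QW) / D_f(P‖Q)` over the probability mass functions `P` with
`0 < D_f(P‖Q) < ∞`. -/
def contractionCoeff {X Y : Type*} [Fintype X] [Fintype Y]
    (f : ℝ → ℝ) (Q : X → ℝ) (W : Matrix X Y ℝ) : EReal :=
  ⨆ P ∈ {P : X → ℝ | P ∈ stdSimplex ℝ X ∧ 0 < fDiv f P Q ∧ fDiv f P Q < ⊤},
    fDiv f (P ᵥ* W) (Q ᵥ* W) / fDiv f P Q

/-- The minimal positive mass of `Q`. -/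
def minMass {X : Type*} (Q : X → ℝ) : ℝ :=
  sInf {q : ℝ | 0 < q ∧ ∃ x, Q x = q}

end SkewDivergence

end

namespace SkewDivergence

open Finset Asymptotics

/-! ### Scalar inequalities -/

/-! Irreducibility makes the stationary `Q` strictly positive, so every divergence from `Q` is a
finite real sum and can be compared with chi-squared. For `f = k_α` or `s_α`, write `k = f''(1)` and
let `m` be the minimal mass of `Q`. Then `k m χ² ≤ D_f ≤ C χ²`: the left side combines Pinsker with
an `ℓ¹`-to-`χ²` bound, the right side is a pointwise quadratic bound on `f`.

The sandwich gives `μ_f ≤ C / (k m) · μ_χ²` for any channel fixing `Q`. Conversely, `D_f ≈ (k / 2)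
χ²` near `Q`, so letting `P` tend to `Q` along a segment gives `μ_χ² ≤ μ_f`. Both are in
`exists_coe_contractionCoeff_comparable`, applied to `W ^ n` directly.

Reversibility enters only in `contractionCoeff_chiSq_pow`: `W` is self-adjoint in the weighted `ℓ²`
space, so `k ↦ χ²(P W^k ‖ Q)` is log-convex and the chi-squared coefficient of `W ^ n` is exactly
the `n`-th power of that of `W`. -/

lemma pinsker_log_bound {t : ℝ} (ht : 0 < t) :
    (t - 1) * (5 * t + 1) / (2 * t * (t + 2)) ≤ Real.log t := by
  set g : ℝ → ℝ := fun t => Real.log t - (t - 1) * (5 * t + 1) / (2 * t * (t + 2)) with hg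
  -- The derivative has the sign of `x - 1`, so `g` has its minimum, zero, at `1`.
  have hder : ∀ x : ℝ, 0 < x → HasDerivAt g ((x - 1) ^ 3 / (x ^ 2 * (x + 2) ^ 2)) x := by
    intro x hx
    have h1 : HasDerivAt (fun t : ℝ => (t - 1) * (5 * t + 1)) (1 * (5 * x + 1) + (x - 1) * 5) x := by
      exact (((hasDerivAt_id' x).sub_const 1).mul
        (((hasDerivAt_id' x).const_mul 5).add_const 1)).congr_deriv (by ring)
    have h2 : HasDerivAt (fun t : ℝ => 2 * t * (t + 2)) (2 * (x + 2) + 2 * x * 1) x := by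
      exact (((hasDerivAt_id' x).const_mul 2).mul
        ((hasDerivAt_id' x).add_const 2)).congr_deriv (by ring)
    have h3 := (Real.hasDerivAt_log hx.ne').sub (h1.div h2 (by positivity))
    refine h3.congr_deriv ?_
    field_simp
    ring
  have hcont : ∀ x : ℝ, 0 < x → ContinuousAt g x := fun x hx => (hder x hx).continuousAt
  have hg1 : g 1 = 0 := by simp [hg]
  suffices h : g 1 ≤ g t by
    rw [hg1] at h
    simpa [hg] using h
  rcases le_total 1 t with h | h
  · refine monotoneOn_of_deriv_nonneg (convex_Ici 1) ?_ ?_ ?_ (Set.mem_Ici.2 le_rfl)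
      (Set.mem_Ici.2 h) h
    · exact fun x hx => (hcont x (lt_of_lt_of_le one_pos hx)).continuousWithinAt
    · intro x hx
      rw [interior_Ici] at hx
      exact (hder x (one_pos.trans hx)).differentiableAt.differentiableWithinAt
    · intro x hx
      rw [interior_Ici] at hx
      rw [(hder x (one_pos.trans hx)).deriv]
      have : 0 ≤ x - 1 := sub_nonneg.2 (le_of_lt hx)
      positivity
  · refine antitoneOn_of_deriv_nonpos (convex_Icc t 1) ?_ ?_ ?_ (Set.left_mem_Icc.2 h)
      (Set.right_mem_Icc.2 h) h
    · exact fun x hx => (hcont x (ht.trans_le hx.1)).continuousWithinAt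
    · intro x hx
      rw [interior_Icc] at hx
      exact (hder x (ht.trans hx.1)).differentiableAt.differentiableWithinAt
    · intro x hx
      rw [interior_Icc] at hx
      rw [(hder x (ht.trans hx.1)).deriv]
      have h3 : (x - 1) ^ 3 ≤ 0 := by
        have : x - 1 ≤ 0 := by linarith [hx.2]
        nlinarith [sq_nonneg (x - 1)]
      exact div_nonpos_of_nonpos_of_nonneg h3 (by positivity)

lemma pinsker_pointwise {t : ℝ} (ht : 0 ≤ t) :
    3 * (t - 1) ^ 2 ≤ (2 * t + 4) * (t * Real.log t - t + 1) := by
  rcases ht.eq_or_lt with rfl | ht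
  · norm_num
  have h := pinsker_log_bound ht
  rw [div_le_iff₀ (by positivity)] at h
  nlinarith

/-- Pinsker's inequality for finitely supported probability mass functions. -/
lemma pinsker {X : Type*} [Fintype X] {p m : X → ℝ} (hp : p ∈ stdSimplex ℝ X)
    (hm : m ∈ stdSimplex ℝ X) (hm0 : ∀ x, 0 < m x) :
    (∑ x, |p x - m x|) ^ 2 ≤ 2 * ∑ x, p x * Real.log (p x / m x) := by
  -- Cauchy–Schwarz with weights of total mass `2`; the added `- p x + m x` sums to zero but makes
  -- each term nonnegative.
  have h : (∑ x, |p x - m x|) ^ 2 ≤ (∑ x, (2 * p x + 4 * m x) / 3) *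
      ∑ x, (p x * Real.log (p x / m x) - p x + m x) := by
    have key : ∀ x, (p x - m x) ^ 2 ≤ (2 * p x + 4 * m x) / 3 *
        (p x * Real.log (p x / m x) - p x + m x) := by
      intro x
      have hmx := hm0 x
      obtain ⟨t, ht⟩ : ∃ t, t = p x / m x := ⟨_, rfl⟩
      have ht0 : 0 ≤ t := ht ▸ div_nonneg (hp.1 x) hmx.le
      have hpt : p x = m x * t := by rw [ht]; field_simp
      rw [← ht, hpt]
      have := mul_le_mul_of_nonneg_left (pinsker_pointwise ht0) (sq_nonneg (m x))
      nlinarith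
    have hf : ∀ x, 0 < (2 * p x + 4 * m x) / 3 := fun x => by
      have := hp.1 x; have := hm0 x; positivity
    have hg : ∀ x, 0 ≤ p x * Real.log (p x / m x) - p x + m x := fun x =>
      nonneg_of_mul_nonneg_right ((sq_nonneg _).trans (key x)) (hf x)
    refine sum_sq_le_sum_mul_sum_of_sq_le_mul _ (fun x _ => (hf x).le) (fun x _ => hg x)
      fun x _ => ?_
    rw [sq_abs]
    exact key x
  have e1 : ∑ x, (2 * p x + 4 * m x) / 3 = 2 := by
    rw [← sum_div, sum_add_distrib, ← mul_sum, ← mul_sum, hp.2, hm.2]; norm_num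
  have e2 : ∑ x, (p x * Real.log (p x / m x) - p x + m x)
      = ∑ x, p x * Real.log (p x / m x) := by
    rw [sum_add_distrib, sum_sub_distrib, hp.2, hm.2]; ring
  rwa [e1, e2] at h

/-- Since `v` has total mass zero, each `|v x|` is at most the sum of the others, hence at most half
of the `ℓ¹` norm. This factor `2` cancels the one in Pinsker. -/
lemma two_mul_sq_sum_div_le {X : Type*} [Fintype X] [DecidableEq X] {v Q : X → ℝ} {m : ℝ}
    (hm : 0 < m) (hQ : ∀ x, m ≤ Q x) (hv : ∑ x, v x = 0) :
    2 * m * ∑ x, v x ^ 2 / Q x ≤ (∑ x, |v x|) ^ 2 := by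
  have h1 : ∀ x, 2 * |v x| ≤ ∑ y, |v y| := by
    intro x
    have e1 := add_sum_erase univ v (mem_univ x)
    have e2 := add_sum_erase univ (fun y => |v y|) (mem_univ x)
    have e3 : v x = -∑ y ∈ univ.erase x, v y := by linarith
    have e4 : |v x| ≤ ∑ y ∈ univ.erase x, |v y| := by
      conv_lhs => rw [e3, abs_neg]
      exact abs_sum_le_sum_abs _ _
    linarith
  rw [sq, sum_mul, mul_sum]
  refine sum_le_sum fun x _ => ?_
  have hQx : 0 < Q x := hm.trans_le (hQ x)
  calc 2 * m * (v x ^ 2 / Q x) = 2 * v x ^ 2 * (m / Q x) := by ring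
    _ ≤ 2 * v x ^ 2 * 1 := by
        gcongr
        exact (div_le_one hQx).2 (hQ x)
    _ = |v x| * (2 * |v x|) := by rw [← sq_abs]; ring
    _ ≤ _ := by gcongr; exact h1 x

/-- The left side is the quadratic in `t` that agrees with `log (1 + r t)` at `0` and is tangent to
it at `1`. Differentiating the gap in `r` instead of `t` leaves a rational function that is visibly
nonnegative, and the gap vanishes at `r = 0`. -/
lemma log_one_add_mul_ge_tangent {r t : ℝ} (hr : 0 ≤ r) (ht : 0 ≤ t) :
    t * Real.log (1 + r) + t * (t - 1) * (r / (1 + r) - Real.log (1 + r))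
      ≤ Real.log (1 + r * t) := by
  set g : ℝ → ℝ := fun r => Real.log (1 + r * t) - t * Real.log (1 + r)
    + t * (t - 1) * (Real.log (1 + r) + (1 + r)⁻¹ - 1) with hg
  have hder : ∀ x : ℝ, 0 ≤ x → HasDerivAt g
      (t * x ^ 2 * (t - 1) ^ 2 / ((1 + x) ^ 2 * (1 + x * t))) x := by
    intro x hx
    have p1 : 0 < 1 + x := by positivity
    have p2 : 0 < 1 + x * t := by positivity
    have d1 : HasDerivAt (fun r : ℝ => 1 + r * t) t x := by
      simpa using ((hasDerivAt_id x).mul_const t).const_add 1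
    have d2 : HasDerivAt (fun r : ℝ => 1 + r) 1 x := (hasDerivAt_id x).const_add 1
    have h := ((d1.log p2.ne').sub ((d2.log p1.ne').const_mul t)).add
      ((((d2.log p1.ne').add (d2.inv p1.ne')).sub_const 1).const_mul (t * (t - 1)))
    refine h.congr_deriv ?_
    field_simp
    ring
  have hmono : MonotoneOn g (Set.Ici 0) := by
    refine monotoneOn_of_deriv_nonneg (convex_Ici 0)
      (fun x hx => (hder x hx).continuousAt.continuousWithinAt) ?_ ?_
    · intro x hx
      rw [interior_Ici] at hx
      exact (hder x (le_of_lt hx)).differentiableAt.differentiableWithinAt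
    · intro x hx
      rw [interior_Ici] at hx
      have hx' : 0 < x := hx
      rw [(hder x hx'.le).deriv]
      positivity
  have h := hmono (Set.mem_Ici.2 le_rfl) (Set.mem_Ici.2 hr) hr
  have h0 : g 0 = 0 := by simp [hg]
  rw [h0] at h
  have p1 : 0 < 1 + r := by positivity
  have e : r / (1 + r) = 1 - (1 + r)⁻¹ := by field_simp; ring
  rw [e]
  simp only [hg] at h
  linarith

lemma neg_log_mix_le {α t : ℝ} (h0 : 0 < α) (h1 : α ≤ 1) (ht : 0 ≤ t) :
    -Real.log (α + (1 - α) * t) ≤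
      -Real.log α * (1 - t) + (-Real.log α - (1 - α)) * (t * (t - 1)) := by
  -- Take `r = (1 - α) / α`, for which `α + (1 - α) t = α (1 + r t)`.
  have hr : 0 ≤ (1 - α) / α := div_nonneg (by linarith) h0.le
  have h := log_one_add_mul_ge_tangent hr ht
  have e1 : 1 + (1 - α) / α = α⁻¹ := by field_simp; ring
  have e2 : 1 + (1 - α) / α * t = (α + (1 - α) * t) / α := by field_simp
  have e3 : (1 - α) / α / α⁻¹ = 1 - α := by field_simp
  have hpos : 0 < α + (1 - α) * t := by
    have : 0 ≤ (1 - α) * t := mul_nonneg (by linarith) ht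
    linarith
  rw [e1, e2, e3, Real.log_inv, Real.log_div hpos.ne' h0.ne'] at h
  linarith

lemma mul_log_sub_log_mix_le {α t : ℝ} (h0 : 0 < α) (h1 : α ≤ 1) (ht : 0 ≤ t) :
    t * Real.log t - t * Real.log (α + (1 - α) * t) ≤ α * (t * (t - 1)) := by
  rcases ht.eq_or_lt with rfl | ht
  · simp
  have hm : 0 ≤ (1 - α) * t := mul_nonneg (by linarith) ht.le
  have hpos : 0 < α + (1 - α) * t := by linarith
  have h : Real.log (t / (α + (1 - α) * t)) ≤ α * (t - 1) := by
    refine (Real.log_le_sub_one_of_pos (by positivity)).trans ?_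
    rw [sub_le_iff_le_add, div_le_iff₀ hpos]
    -- The mixture minus `1` is `(1 - α) (t - 1)`, so the gap is exactly `α (1 - α) (t - 1)²`.
    nlinarith [mul_nonneg (mul_nonneg h0.le (sub_nonneg.2 h1)) (sq_nonneg (t - 1))]
  rw [Real.log_div ht.ne' hpos.ne'] at h
  nlinarith

/-! ### Second-order expansions -/

lemma log_one_add_isLittleO :
    (fun x : ℝ => Real.log (1 + x) - x + x ^ 2 / 2) =o[𝓝 0] fun x => x ^ 2 := by
  have hO : (fun x : ℝ => Real.log (1 + x) - x + x ^ 2 / 2) =O[𝓝 0] fun x => x ^ 3 := by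
    refine IsBigO.of_bound 2 ?_
    have : ∀ᶠ x : ℝ in 𝓝 0, |x| < 1 / 2 := by
      have := Metric.ball_mem_nhds (0 : ℝ) (show (0 : ℝ) < 1 / 2 by norm_num)
      filter_upwards [this] with x hx
      simpa using hx
    filter_upwards [this] with x hx
    have h := Real.abs_log_sub_add_sum_range_le (x := -x) (by rw [abs_neg]; linarith) 2
    have e : ∑ i ∈ range 2, (-x) ^ (i + 1) / ((i : ℝ) + 1) + Real.log (1 - -x)
        = Real.log (1 + x) - x + x ^ 2 / 2 := by
      rw [sum_range_succ, sum_range_one, sub_neg_eq_add]; norm_num; ring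
    rw [e, abs_neg] at h
    rw [Real.norm_eq_abs, Real.norm_eq_abs, abs_pow]
    refine h.trans ?_
    rw [div_le_iff₀ (by linarith)]
    have : 0 ≤ |x| ^ 3 := by positivity
    norm_num
    nlinarith
  exact hO.trans_isLittleO (isLittleO_pow_pow (by norm_num))

lemma log_one_add_mul_isLittleO (β : ℝ) :
    (fun x : ℝ => Real.log (1 + β * x) - β * x + (β * x) ^ 2 / 2) =o[𝓝 0] fun x => x ^ 2 := by
  have ht : Tendsto (fun x : ℝ => β * x) (𝓝 0) (𝓝 0) := by
    have : Continuous fun x : ℝ => β * x := by fun_prop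
    simpa using this.tendsto 0
  refine (log_one_add_isLittleO.comp_tendsto ht).trans_isBigO ?_
  refine IsBigO.of_bound (β ^ 2) (Eventually.of_forall fun x => ?_)
  simp [mul_pow]

/-! ### Divergences as real sums -/

/-- The real-valued sum `∑ Q f(P/Q)`, which is `D_f(P‖Q)` when `Q > 0` and `f` is right-continuous
at `0`. -/
noncomputable def realFDiv {X : Type*} [Fintype X] (f : ℝ → ℝ) (P Q : X → ℝ) : ℝ :=
  ∑ x, Q x * f (P x / Q x)

variable {X : Type*} [Fintype X]

lemma ereal_coe_sum (g : X → ℝ) : ((∑ x, g x : ℝ) : EReal) = ∑ x, (g x : EReal) :=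
  map_sum (⟨⟨Real.toEReal, EReal.coe_zero⟩, EReal.coe_add⟩ : ℝ →+ EReal) g univ

lemma fDiv_eq_coe {f : ℝ → ℝ} (hf : Tendsto f (𝓝[>] 0) (𝓝 (f 0))) {P Q : X → ℝ}
    (hP : ∀ x, 0 ≤ P x) (hQ : ∀ x, 0 < Q x) : fDiv f P Q = (realFDiv f P Q : EReal) := by
  rw [fDiv, realFDiv, ereal_coe_sum]
  refine sum_congr rfl fun x _ => ?_
  rw [fDivTerm, if_pos (hQ x)]
  rcases (hP x).eq_or_lt with h | h
  · have hlim : Tendsto (fun t : ℝ => (f t : EReal)) (𝓝[>] 0) (𝓝 (f 0 : EReal)) :=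
      (continuous_coe_real_ereal.tendsto _).comp hf
    rw [← h, if_neg (lt_irrefl _), hlim.limUnder_eq, zero_div, EReal.coe_mul]
  · rw [if_pos h]

lemma realFDiv_chiSq {P Q : X → ℝ} (hQ : ∀ x, 0 < Q x) :
    realFDiv chiSqFun P Q = ∑ x, (P x - Q x) ^ 2 / Q x := by
  refine sum_congr rfl fun x _ => ?_
  have := (hQ x).ne'
  rw [chiSqFun]
  field_simp

lemma realFDiv_chiSq_nonneg {P Q : X → ℝ} (hQ : ∀ x, 0 < Q x) : 0 ≤ realFDiv chiSqFun P Q := by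
  rw [realFDiv_chiSq hQ]
  exact sum_nonneg fun x _ => div_nonneg (sq_nonneg _) (hQ x).le

lemma realFDiv_chiSq_self {Q : X → ℝ} (hQ : ∀ x, 0 < Q x) : realFDiv chiSqFun Q Q = 0 := by
  simp [realFDiv_chiSq hQ]

lemma eq_of_realFDiv_chiSq_eq_zero {P Q : X → ℝ} (hQ : ∀ x, 0 < Q x)
    (h : realFDiv chiSqFun P Q = 0) : P = Q := by
  rw [realFDiv_chiSq hQ, sum_eq_zero_iff_of_nonneg
    fun x _ => div_nonneg (sq_nonneg _) (hQ x).le] at h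
  funext x
  have := h x (mem_univ x)
  rw [div_eq_zero_iff, or_iff_left (hQ x).ne', sq_eq_zero_iff, sub_eq_zero] at this
  exact this

lemma exists_realFDiv_chiSq_pos [DecidableEq X] [Nontrivial X] {Q : X → ℝ} (hQ : ∀ x, 0 < Q x) :
    ∃ P ∈ stdSimplex ℝ X, 0 < realFDiv chiSqFun P Q := by
  obtain ⟨x, y, hxy⟩ := exists_pair_ne X
  refine ⟨Pi.single x 1, single_mem_stdSimplex ℝ x,
    (realFDiv_chiSq_nonneg hQ).lt_of_ne fun h => ?_⟩
  have := congrFun (eq_of_realFDiv_chiSq_eq_zero hQ h.symm) y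
  rw [Pi.single_eq_of_ne hxy.symm] at this
  exact (hQ y).ne this

/-- With `t = P / Q`, the `Q`-average of `1 - t` is zero and that of `t (t - 1)` is chi-squared. -/
lemma realFDiv_le_of_pointwise {f : ℝ → ℝ} {C : ℝ}
    (hf : ∀ t, 0 ≤ t → f t ≤ f 0 * (1 - t) + C * (t * (t - 1))) {P Q : X → ℝ}
    (hP : P ∈ stdSimplex ℝ X) (hQ : Q ∈ stdSimplex ℝ X) (hQ0 : ∀ x, 0 < Q x) :
    realFDiv f P Q ≤ C * realFDiv chiSqFun P Q := by
  have h : ∀ x, Q x * f (P x / Q x) ≤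
      (f 0 - C) * (Q x - P x) + C * (Q x * chiSqFun (P x / Q x)) := by
    intro x
    obtain ⟨t, ht⟩ : ∃ t, t = P x / Q x := ⟨_, rfl⟩
    have hx := hQ0 x
    have hPt : P x = Q x * t := by rw [ht]; field_simp
    have := mul_le_mul_of_nonneg_left (hf t (ht ▸ div_nonneg (hP.1 x) hx.le)) hx.le
    rw [← ht, hPt, chiSqFun]
    linarith
  refine (sum_le_sum fun x _ => h x).trans_eq ?_
  rw [sum_add_distrib, ← mul_sum, ← mul_sum, sum_sub_distrib, hP.2, hQ.2, realFDiv]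
  ring

/-- The linear coefficient `c` drops out because `P - Q` has total mass zero, so only the quadratic
term survives division by `ε ^ 2`. -/
lemma tendsto_realFDiv_div_sq {f : ℝ → ℝ} {c k : ℝ}
    (hf : (fun x => f (1 + x) - c * x - k / 2 * x ^ 2) =o[𝓝 0] fun x : ℝ => x ^ 2) {P Q : X → ℝ}
    (hP : P ∈ stdSimplex ℝ X) (hQ : Q ∈ stdSimplex ℝ X) (hQ0 : ∀ x, 0 < Q x) :
    Tendsto (fun ε : ℝ => realFDiv f ((1 - ε) • Q + ε • P) Q / ε ^ 2) (𝓝[>] 0)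
      (𝓝 (k / 2 * realFDiv chiSqFun P Q)) := by
  have key : ∀ u : ℝ, Tendsto (fun ε : ℝ => (f (1 + ε * u) - c * (ε * u)) / ε ^ 2) (𝓝[>] 0)
      (𝓝 (k / 2 * u ^ 2)) := by
    intro u
    have ht : Tendsto (fun ε : ℝ => ε * u) (𝓝[>] 0) (𝓝 0) := by
      have : Continuous fun x : ℝ => x * u := by fun_prop
      simpa using (this.tendsto 0).mono_left nhdsWithin_le_nhds
    have h1 : (fun ε : ℝ => f (1 + ε * u) - c * (ε * u) - k / 2 * (ε * u) ^ 2)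
        =o[𝓝[>] 0] fun ε : ℝ => ε ^ 2 := by
      refine (hf.comp_tendsto ht).trans_isBigO ?_
      refine IsBigO.of_bound (u ^ 2) (Eventually.of_forall fun x => ?_)
      simp [mul_pow, mul_comm]
    have h2 := h1.tendsto_div_nhds_zero.add_const (k / 2 * u ^ 2)
    rw [zero_add] at h2
    refine h2.congr' ?_
    filter_upwards [self_mem_nhdsWithin] with ε hε
    have : ε ≠ 0 := ne_of_gt hε
    field_simp
    ring
  have hsum := tendsto_finsetSum univ fun x _ => (key (P x / Q x - 1)).const_mul (Q x)
  have e1 : ∑ x, Q x * (k / 2 * (P x / Q x - 1) ^ 2) = k / 2 * realFDiv chiSqFun P Q := by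
    rw [realFDiv, mul_sum]
    exact sum_congr rfl fun x _ => by rw [chiSqFun]; ring
  rw [e1] at hsum
  refine hsum.congr' ?_
  filter_upwards [self_mem_nhdsWithin] with ε hε
  have e2 : ∀ x, Q x * ((f (1 + ε * (P x / Q x - 1)) - c * (ε * (P x / Q x - 1))) / ε ^ 2)
      = Q x * f (((1 - ε) • Q + ε • P) x / Q x) / ε ^ 2 - c * ε / ε ^ 2 * (P x - Q x) := by
    intro x
    have hx := (hQ0 x).ne'
    have e3 : ((1 - ε) • Q + ε • P) x / Q x = 1 + ε * (P x / Q x - 1) := by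
      simp only [Pi.add_apply, Pi.smul_apply, smul_eq_mul]
      field_simp
      ring
    rw [e3]
    have : Q x * (P x / Q x - 1) = P x - Q x := by field_simp
    rw [← this]
    ring
  rw [sum_congr rfl fun x _ => e2 x, sum_sub_distrib, ← mul_sum, ← sum_div, sum_sub_distrib,
    hP.2, hQ.2, realFDiv]
  ring

lemma minMass_pos_and_le [Nonempty X] {Q : X → ℝ} (hQ : ∀ x, 0 < Q x) :
    0 < minMass Q ∧ ∀ x, minMass Q ≤ Q x := by
  have hs : {q : ℝ | 0 < q ∧ ∃ x, Q x = q} = Set.range Q := by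
    ext q
    exact ⟨fun h => h.2, fun ⟨x, hx⟩ => ⟨hx ▸ hQ x, x, hx⟩⟩
  rw [minMass, hs]
  refine ⟨?_, fun x => csInf_le (Set.finite_range Q).bddBelow ⟨x, rfl⟩⟩
  obtain ⟨x, hx⟩ := (Set.range_nonempty Q).csInf_mem (Set.finite_range Q)
  exact hx ▸ hQ x

/-! ### Contraction coefficients as real suprema -/

/-- Replaces the extended-real supremum by a least real constant: `hne` excludes `⊥` and `hbdd`
excludes `⊤`. -/
lemma exists_coe_contractionCoeff {f : ℝ → ℝ} (hf : Tendsto f (𝓝[>] 0) (𝓝 (f 0)))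
    {Q : X → ℝ} (hQ0 : ∀ x, 0 < Q x) {R : Matrix X X ℝ} (hQR : Q ᵥ* R = Q)
    (hR : ∀ P ∈ stdSimplex ℝ X, P ᵥ* R ∈ stdSimplex ℝ X)
    (hne : ∃ P ∈ stdSimplex ℝ X, 0 < realFDiv f P Q)
    (hbdd : ∃ c : ℝ, ∀ P ∈ stdSimplex ℝ X, 0 < realFDiv f P Q →
      realFDiv f (P ᵥ* R) Q ≤ c * realFDiv f P Q) :
    ∃ μ : ℝ, contractionCoeff f Q R = μ ∧
      (∀ P ∈ stdSimplex ℝ X, 0 < realFDiv f P Q →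
        realFDiv f (P ᵥ* R) Q ≤ μ * realFDiv f P Q) ∧
      ∀ c : ℝ, (∀ P ∈ stdSimplex ℝ X, 0 < realFDiv f P Q →
        realFDiv f (P ᵥ* R) Q ≤ c * realFDiv f P Q) → μ ≤ c := by
  have hcoe : ∀ P ∈ stdSimplex ℝ X, fDiv f P Q = (realFDiv f P Q : EReal) :=
    fun P hP => fDiv_eq_coe hf hP.1 hQ0
  have hle : ∀ P ∈ stdSimplex ℝ X, 0 < realFDiv f P Q →
      ((realFDiv f (P ᵥ* R) Q / realFDiv f P Q : ℝ) : EReal) ≤ contractionCoeff f Q R := by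
    intro P hP h
    have hmem : P ∈ {P : X → ℝ | P ∈ stdSimplex ℝ X ∧ 0 < fDiv f P Q ∧ fDiv f P Q < ⊤} := by
      refine ⟨hP, ?_, ?_⟩ <;> rw [hcoe P hP]
      · exact_mod_cast h
      · exact EReal.coe_lt_top _
    have : fDiv f (P ᵥ* R) (Q ᵥ* R) / fDiv f P Q ≤ contractionCoeff f Q R := le_iSup₂ (f := fun (P : X → ℝ) (_ : P ∈ {P : X → ℝ | P ∈ stdSimplex ℝ X ∧
      0 < fDiv f P Q ∧ fDiv f P Q < ⊤}) => fDiv f (P ᵥ* R) (Q ᵥ* R) / fDiv f P Q) P hmem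
    rwa [hQR, hcoe P hP, hcoe _ (hR P hP), ← EReal.coe_div] at this
  have hge : ∀ c : ℝ, (∀ P ∈ stdSimplex ℝ X, 0 < realFDiv f P Q →
      realFDiv f (P ᵥ* R) Q ≤ c * realFDiv f P Q) → contractionCoeff f Q R ≤ c := by
    intro c hc
    refine iSup₂_le fun P hP => ?_
    obtain ⟨hP, hpos, -⟩ := hP
    rw [hcoe P hP] at hpos
    have hpos' : 0 < realFDiv f P Q := by exact_mod_cast hpos
    rw [hQR, hcoe P hP, hcoe _ (hR P hP), ← EReal.coe_div, EReal.coe_le_coe_iff,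
      div_le_iff₀ hpos']
    exact hc P hP hpos'
  obtain ⟨P, hP, hpos⟩ := hne
  obtain ⟨c, hc⟩ := hbdd
  have htop : contractionCoeff f Q R ≠ ⊤ := ((hge c hc).trans_lt (EReal.coe_lt_top c)).ne
  have hbot : contractionCoeff f Q R ≠ ⊥ := ((EReal.bot_lt_coe _).trans_le (hle P hP hpos)).ne'
  have hμ := EReal.coe_toReal htop hbot
  refine ⟨_, hμ.symm, fun P hP h => ?_, fun c hc => ?_⟩
  · have := hle P hP h
    rwa [← hμ, EReal.coe_le_coe_iff, div_le_iff₀ h] at this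
  · have := hge c hc
    rwa [← hμ, EReal.coe_le_coe_iff] at this

/-! ### Stochastic matrices -/

lemma vecMul_mem_stdSimplex [DecidableEq X] {R : Matrix X X ℝ} (hR : R ∈ rowStochastic ℝ X)
    {P : X → ℝ} (hP : P ∈ stdSimplex ℝ X) : P ᵥ* R ∈ stdSimplex ℝ X := by
  refine ⟨fun y => nonneg_vecMul_of_mem_rowStochastic hR hP.1 y, ?_⟩
  have := vecMul_dotProduct_one_eq_one_rowStochastic hR (x := P) (by simpa [dotProduct] using hP.2)
  simpa [dotProduct] using this

lemma vecMul_pow_eq_self [DecidableEq X] {Q : X → ℝ} {W : Matrix X X ℝ} (h : Q ᵥ* W = Q) (n : ℕ) :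
    Q ᵥ* W ^ n = Q := by
  induction n with
  | zero => simp
  | succ n ih => rw [pow_succ, ← vecMul_vecMul, ih, h]

/-- A stationary distribution of an irreducible matrix is positive. -/
lemma pos_of_isIrreducible [DecidableEq X] {Q : X → ℝ} {W : Matrix X X ℝ} (hW : W.IsIrreducible)
    (hQ : Q ∈ stdSimplex ℝ X) (hstat : Q ᵥ* W = Q) (y : X) : 0 < Q y := by
  obtain ⟨x, hx⟩ : ∃ x, 0 < Q x := by
    by_contra! h
    have := sum_nonpos fun x (_ : x ∈ univ) => h x
    linarith [hQ.2]
  obtain ⟨k, -, hk⟩ := (isIrreducible_iff_exists_pow_pos hW.nonneg).1 hW x y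
  rw [← vecMul_pow_eq_self hstat k]
  have hnn : ∀ z, 0 ≤ (W ^ k) z y := fun z => pow_apply_nonneg hW.nonneg k z y
  exact (mul_pos hx hk).trans_le
    (single_le_sum (f := fun z => Q z * (W ^ k) z y)
      (fun z _ => mul_nonneg (hQ.1 z) (hnn z)) (mem_univ x))

/-- Cauchy–Schwarz in each column, with weights `Q x * R x y` summing to `Q y`. It supplies the
finiteness of the chi-squared coefficient. -/
lemma sum_vecMul_sq_div_le {Q v : X → ℝ} {R : Matrix X X ℝ} (hR : ∀ x y, 0 ≤ R x y)
    (hsum : ∀ x, ∑ y, R x y = 1) (hQ0 : ∀ x, 0 < Q x) (hQR : Q ᵥ* R = Q) :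
    ∑ y, (v ᵥ* R) y ^ 2 / Q y ≤ ∑ x, v x ^ 2 / Q x := by
  have h : ∀ y, (v ᵥ* R) y ^ 2 / Q y ≤ ∑ x, v x ^ 2 / Q x * R x y := by
    intro y
    have hcs : (∑ x, v x * R x y) ^ 2 ≤
        (∑ x, v x ^ 2 / Q x * R x y) * ∑ x, Q x * R x y := by
      refine sum_sq_le_sum_mul_sum_of_sq_le_mul _
        (fun x _ => mul_nonneg (div_nonneg (sq_nonneg _) (hQ0 x).le) (hR x y))
        (fun x _ => mul_nonneg (hQ0 x).le (hR x y)) fun x _ => le_of_eq ?_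
      have := (hQ0 x).ne'
      field_simp
    have e : ∑ x, Q x * R x y = Q y := congrFun hQR y
    rw [e] at hcs
    rw [div_le_iff₀ (hQ0 y)]
    exact hcs
  refine (sum_le_sum fun y _ => h y).trans_eq ?_
  rw [sum_comm]
  exact sum_congr rfl fun x _ => by rw [← mul_sum, hsum x, mul_one]

/-- Reversibility makes `v ↦ v W` self-adjoint for the inner product weighted by `1 / Q`. -/
lemma sum_vecMul_mul_div_comm {Q u v : X → ℝ} {W : Matrix X X ℝ} (hQ0 : ∀ x, 0 < Q x)
    (hrev : ∀ x y, Q x * W x y = Q y * W y x) :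
    ∑ y, (u ᵥ* W) y * v y / Q y = ∑ y, u y * (v ᵥ* W) y / Q y := by
  have e1 : ∀ y, (u ᵥ* W) y * v y / Q y = ∑ x, u x * W x y * v y / Q y := fun y => by
    rw [vecMul, dotProduct, sum_mul, sum_div]
  have e2 : ∀ y, u y * (v ᵥ* W) y / Q y = ∑ x, u y * (v x * W x y) / Q y := fun y => by
    rw [vecMul, dotProduct, mul_sum, sum_div]
  rw [sum_congr rfl fun y _ => e1 y, sum_congr rfl fun y _ => e2 y, sum_comm]
  refine sum_congr rfl fun x _ => sum_congr rfl fun y _ => ?_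
  have hx := (hQ0 x).ne'
  have hy := (hQ0 y).ne'
  have : W x y / Q y = W y x / Q x := by
    rw [div_eq_div_iff hy hx]; linarith [hrev x y]
  calc u x * W x y * v y / Q y = u x * v y * (W x y / Q y) := by ring
    _ = _ := by rw [this]; ring

/-- Self-adjointness gives `‖vW‖² = ⟨v, vW²⟩`, and Cauchy–Schwarz then yields log-convexity of `k ↦
‖vW^k‖²`. -/
lemma sum_vecMul_sq_div_sq_le {Q v : X → ℝ} {W : Matrix X X ℝ} (hQ0 : ∀ x, 0 < Q x)
    (hrev : ∀ x y, Q x * W x y = Q y * W y x) :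
    (∑ y, (v ᵥ* W) y ^ 2 / Q y) ^ 2 ≤
      (∑ y, v y ^ 2 / Q y) * ∑ y, (v ᵥ* W ᵥ* W) y ^ 2 / Q y := by
  have e : ∑ y, (v ᵥ* W) y ^ 2 / Q y = ∑ y, v y * (v ᵥ* W ᵥ* W) y / Q y := by
    rw [← sum_vecMul_mul_div_comm hQ0 hrev]
    exact sum_congr rfl fun y _ => by rw [sq]
  rw [e]
  refine sum_sq_le_sum_mul_sum_of_sq_le_mul _ (fun x _ => div_nonneg (sq_nonneg _) (hQ0 x).le)
    (fun x _ => div_nonneg (sq_nonneg _) (hQ0 x).le) fun x _ => le_of_eq ?_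
  have := (hQ0 x).ne'
  field_simp

/-- Successive ratios of a log-convex sequence never fall below the first one. -/
lemma pow_mul_le_of_sq_le_mul {a : ℕ → ℝ} (ha : ∀ k, 0 ≤ a k)
    (hlog : ∀ k, a (k + 1) ^ 2 ≤ a k * a (k + 2)) (h0 : 0 < a 0) (n : ℕ) :
    (a 1 / a 0) ^ n * a 0 ≤ a n := by
  rcases (ha 1).eq_or_lt with h1 | h1
  · rw [← h1, zero_div]
    rcases n with _ | n
    · simp
    · simpa using ha (n + 1)
  have h : ∀ k, 0 < a k ∧ a 1 / a 0 * a k ≤ a (k + 1) := by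
    intro k
    induction k with
    | zero => exact ⟨h0, by rw [div_mul_cancel₀ _ h0.ne']⟩
    | succ k ih =>
      obtain ⟨hk, hk'⟩ := ih
      have hpos : 0 < a (k + 1) := lt_of_lt_of_le (by positivity) hk'
      refine ⟨hpos, ?_⟩
      have e1 := hlog k
      have : a k * (a 1 / a 0 * a (k + 1)) ≤ a k * a (k + 2) := by
        refine le_trans ?_ e1
        have := mul_le_mul_of_nonneg_right hk' hpos.le
        linarith
      exact le_of_mul_le_mul_left this hk
  induction n with
  | zero => simp
  | succ n ih =>
    refine le_trans ?_ (h n).2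
    rw [pow_succ', mul_assoc]
    gcongr

/-! ### Comparison of contraction coefficients with the chi-squared one -/

/-- The local and global comparison of `D_f(·‖Q)` with `χ²(·‖Q)`. -/
structure ChiSqComparable (f : ℝ → ℝ) (Q : X → ℝ) (k m C : ℝ) : Prop where
  tendsto_zero : Tendsto f (𝓝[>] 0) (𝓝 (f 0))
  k_pos : 0 < k
  m_pos : 0 < m
  le_chiSq : ∀ P ∈ stdSimplex ℝ X, realFDiv f P Q ≤ C * realFDiv chiSqFun P Q
  chiSq_le : ∀ P ∈ stdSimplex ℝ X, k * m * realFDiv chiSqFun P Q ≤ realFDiv f P Q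
  expansion : ∃ c, (fun x => f (1 + x) - c * x - k / 2 * x ^ 2) =o[𝓝 0] fun x : ℝ => x ^ 2

lemma tendsto_chiSqFun_zero : Tendsto chiSqFun (𝓝[>] 0) (𝓝 (chiSqFun 0)) := by
  have : Continuous chiSqFun := by unfold chiSqFun; fun_prop
  exact (this.tendsto 0).mono_left nhdsWithin_le_nhds

section

variable [DecidableEq X] {Q : X → ℝ} {R : Matrix X X ℝ}

lemma realFDiv_chiSq_vecMul_le (hQ0 : ∀ x, 0 < Q x)
    (hQR : Q ᵥ* R = Q) (hR : R ∈ rowStochastic ℝ X) (P : X → ℝ) :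
    realFDiv chiSqFun (P ᵥ* R) Q ≤ realFDiv chiSqFun P Q := by
  rw [realFDiv_chiSq hQ0, realFDiv_chiSq hQ0]
  have h := sum_vecMul_sq_div_le (R := R) (v := P - Q) (fun x y => nonneg_of_mem_rowStochastic hR)
    (sum_row_of_mem_rowStochastic hR) hQ0 hQR
  rw [sub_vecMul, hQR] at h
  exact h

variable [Nontrivial X]

lemma exists_coe_contractionCoeff_chiSq (hQ0 : ∀ x, 0 < Q x)
    (hQR : Q ᵥ* R = Q) (hR : R ∈ rowStochastic ℝ X) :
    ∃ μ : ℝ, contractionCoeff chiSqFun Q R = μ ∧ 0 ≤ μ ∧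
      (∀ P ∈ stdSimplex ℝ X, realFDiv chiSqFun (P ᵥ* R) Q ≤ μ * realFDiv chiSqFun P Q) ∧
      ∀ c : ℝ, (∀ P ∈ stdSimplex ℝ X, 0 < realFDiv chiSqFun P Q →
        realFDiv chiSqFun (P ᵥ* R) Q ≤ c * realFDiv chiSqFun P Q) → μ ≤ c := by
  have hne := exists_realFDiv_chiSq_pos hQ0
  obtain ⟨μ, h1, h2, h3⟩ := exists_coe_contractionCoeff tendsto_chiSqFun_zero hQ0 hQR
    (fun P hP => vecMul_mem_stdSimplex hR hP) hne
    ⟨1, fun P _ _ => by rw [one_mul]; exact realFDiv_chiSq_vecMul_le hQ0 hQR hR P⟩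
  refine ⟨μ, h1, ?_, fun P hP => ?_, h3⟩
  · obtain ⟨P, hP, hpos⟩ := hne
    exact nonneg_of_mul_nonneg_left ((realFDiv_chiSq_nonneg hQ0).trans (h2 P hP hpos)) hpos
  · rcases (realFDiv_chiSq_nonneg (P := P) hQ0).eq_or_lt with h | h
    · rw [eq_of_realFDiv_chiSq_eq_zero hQ0 h.symm, hQR, realFDiv_chiSq_self hQ0, mul_zero]
    · exact h2 P hP h

theorem exists_coe_contractionCoeff_comparable {f : ℝ → ℝ} {k m C : ℝ}
    (hf : ChiSqComparable f Q k m C) (hQ : Q ∈ stdSimplex ℝ X) (hQ0 : ∀ x, 0 < Q x)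
    (hQR : Q ᵥ* R = Q) (hR : R ∈ rowStochastic ℝ X)
    {μ : ℝ} (hμ : contractionCoeff chiSqFun Q R = μ) :
    ∃ ν : ℝ, contractionCoeff f Q R = ν ∧ μ ≤ ν ∧ ν ≤ C / (k * m) * μ ∧
      ∀ P ∈ stdSimplex ℝ X, realFDiv f (P ᵥ* R) Q ≤ ν * realFDiv f P Q := by
  obtain ⟨μ', h1, hμ0, h2, h3⟩ := exists_coe_contractionCoeff_chiSq hQ0 hQR hR
  obtain rfl : μ = μ' := by rw [hμ] at h1; exact_mod_cast h1
  have hmem : ∀ P ∈ stdSimplex ℝ X, P ᵥ* R ∈ stdSimplex ℝ X :=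
    fun P hP => vecMul_mem_stdSimplex hR hP
  have hkm : 0 < k * m := mul_pos hf.k_pos hf.m_pos
  obtain ⟨P₀, hP₀, hpos₀⟩ := exists_realFDiv_chiSq_pos hQ0
  have hC : 0 ≤ C := by
    have := (hf.chiSq_le P₀ hP₀).trans (hf.le_chiSq P₀ hP₀)
    exact hkm.le.trans (le_of_mul_le_mul_right this hpos₀)
  have hbdd : ∀ P ∈ stdSimplex ℝ X, 0 < realFDiv f P Q →
      realFDiv f (P ᵥ* R) Q ≤ C / (k * m) * μ * realFDiv f P Q := by
    intro P hP _
    calc realFDiv f (P ᵥ* R) Q ≤ C * realFDiv chiSqFun (P ᵥ* R) Q := hf.le_chiSq _ (hmem P hP)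
      _ ≤ C * (μ * realFDiv chiSqFun P Q) := by gcongr; exact h2 P hP
      _ = C / (k * m) * μ * (k * m * realFDiv chiSqFun P Q) := by
          have := hkm.ne'
          field_simp [hf.k_pos.ne', hf.m_pos.ne']
      _ ≤ _ := by gcongr; exact hf.chiSq_le P hP
  obtain ⟨ν, hν, h4, h5⟩ := exists_coe_contractionCoeff hf.tendsto_zero hQ0 hQR hmem
    ⟨P₀, hP₀, (mul_pos hkm hpos₀).trans_le (hf.chiSq_le P₀ hP₀)⟩ ⟨_, hbdd⟩
  refine ⟨ν, hν, h3 ν fun P hP hpos => ?_, h5 _ hbdd, fun P hP => ?_⟩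
  -- Apply the `f`-contraction at `(1 - ε) Q + ε P`, divide by `ε ^ 2` and let `ε → 0+`; the common
  -- factor `k / 2` cancels.
  · obtain ⟨c, hc⟩ := hf.expansion
    have t1 := tendsto_realFDiv_div_sq hc (hmem P hP) hQ hQ0
    have t2 := (tendsto_realFDiv_div_sq hc hP hQ hQ0).const_mul ν
    have hlim := le_of_tendsto_of_tendsto t1 t2 ?_
    · have := hf.k_pos
      refine le_of_mul_le_mul_left (hlim.trans_eq ?_) (half_pos this)
      ring
    have hlt : ∀ᶠ ε : ℝ in 𝓝[>] 0, ε < 1 :=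
      (eventually_lt_nhds one_pos).filter_mono nhdsWithin_le_nhds
    filter_upwards [self_mem_nhdsWithin, hlt] with ε hε hε1
    have hε0 : 0 < ε := hε
    have hPε : (1 - ε) • Q + ε • P ∈ stdSimplex ℝ X :=
      convex_stdSimplex ℝ X hQ hP (by linarith) hε0.le (by ring)
    have hχ : 0 < realFDiv chiSqFun ((1 - ε) • Q + ε • P) Q := by
      refine (realFDiv_chiSq_nonneg hQ0).lt_of_ne fun h => hpos.ne' ?_
      have e := eq_of_realFDiv_chiSq_eq_zero hQ0 h.symm
      have : P = Q := by
        funext x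
        have := congrFun e x
        simp only [Pi.add_apply, Pi.smul_apply, smul_eq_mul] at this
        exact mul_left_cancel₀ hε0.ne' (by linarith)
      rw [this, realFDiv_chiSq_self hQ0]
    have := h4 _ hPε ((mul_pos hkm hχ).trans_le (hf.chiSq_le _ hPε))
    rw [add_vecMul, smul_vecMul, smul_vecMul, hQR] at this
    rw [← mul_div_assoc]
    gcongr
  · rcases (realFDiv_chiSq_nonneg (P := P) hQ0).eq_or_lt with h | h
    -- Here `P = Q`, outside the range of the supremum; the two comparison bounds force the
    -- `f`-divergence to vanish.
    · obtain rfl := eq_of_realFDiv_chiSq_eq_zero hQ0 h.symm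
      have e1 := hf.le_chiSq P hP
      have e2 := hf.chiSq_le P hP
      rw [realFDiv_chiSq_self hQ0, mul_zero] at e1 e2
      rw [hQR, le_antisymm e1 e2, mul_zero]
    · exact h4 P hP ((mul_pos hkm h).trans_le (hf.chiSq_le P hP))

/-- For a reversible chain, the chi-squared contraction coefficient of `W ^ n` is the `n`-th power
of that of `W`. -/
theorem contractionCoeff_chiSq_pow {W : Matrix X X ℝ} (hQ0 : ∀ x, 0 < Q x)
    (hstat : Q ᵥ* W = Q) (hW : W ∈ rowStochastic ℝ X)
    (hrev : ∀ x y, Q x * W x y = Q y * W y x) (n : ℕ) :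
    contractionCoeff chiSqFun Q (W ^ n) = contractionCoeff chiSqFun Q W ^ n := by
  have hQn := vecMul_pow_eq_self hstat
  obtain ⟨μ, h1, hμ0, h2, h3⟩ := exists_coe_contractionCoeff_chiSq hQ0 hstat hW
  obtain ⟨ν, g1, hν0, g2, g3⟩ := exists_coe_contractionCoeff_chiSq hQ0 (hQn n) (pow_mem hW n)
  rw [h1, g1, ← EReal.coe_pow, EReal.coe_eq_coe_iff]
  refine le_antisymm (g3 _ fun P hP _ => ?_) ?_
  · have : ∀ k, realFDiv chiSqFun (P ᵥ* W ^ k) Q ≤ μ ^ k * realFDiv chiSqFun P Q := by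
      intro k
      induction k with
      | zero => simp
      | succ k ih =>
        rw [pow_succ W, ← vecMul_vecMul, pow_succ', mul_assoc]
        exact (h2 _ (vecMul_mem_stdSimplex (pow_mem hW k) hP)).trans (by gcongr)
    exact this n
  · have key : ∀ P ∈ stdSimplex ℝ X, 0 < realFDiv chiSqFun P Q →
        (realFDiv chiSqFun (P ᵥ* W) Q / realFDiv chiSqFun P Q) ^ n ≤ ν := by
      intro P hP hpos
      have hd : ∀ k, realFDiv chiSqFun (P ᵥ* W ^ k) Q =
          ∑ y, ((P - Q) ᵥ* W ^ k) y ^ 2 / Q y := fun k => by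
        rw [realFDiv_chiSq hQ0, sub_vecMul, hQn]; rfl
      have h := pow_mul_le_of_sq_le_mul (a := fun k => realFDiv chiSqFun (P ᵥ* W ^ k) Q)
        (fun k => realFDiv_chiSq_nonneg hQ0)
        (fun k => by
          have := sum_vecMul_sq_div_sq_le (v := (P - Q) ᵥ* W ^ k) hQ0 hrev
          rw [vecMul_vecMul, ← pow_succ, vecMul_vecMul, ← pow_succ] at this
          simpa only [hd] using this) (by simpa using hpos) n
      simp only [pow_one, pow_zero, vecMul_one] at h
      exact le_of_mul_le_mul_right (h.trans (g2 P hP)) hpos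
    -- For `n > 0`, take `n`-th roots in `key` so that the leastness of `μ` applies to the ratios
    -- themselves; `n = 0` has no root.
    rcases Nat.eq_zero_or_pos n with rfl | hn
    · obtain ⟨P, hP, hpos⟩ := exists_realFDiv_chiSq_pos hQ0
      simpa using key P hP hpos
    · have hroot : μ ≤ ν ^ ((n : ℝ)⁻¹) := by
        refine h3 _ fun P hP hpos => ?_
        rw [← div_le_iff₀ hpos]
        have hr : 0 ≤ realFDiv chiSqFun (P ᵥ* W) Q / realFDiv chiSqFun P Q :=
          div_nonneg (realFDiv_chiSq_nonneg hQ0) hpos.le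
        rw [← Real.pow_rpow_inv_natCast hr hn.ne']
        exact Real.rpow_le_rpow (by positivity) (key P hP hpos) (by positivity)
      calc μ ^ n ≤ (ν ^ ((n : ℝ)⁻¹)) ^ n := by gcongr
        _ = ν := Real.rpow_inv_natCast_pow hν0 hn.ne'

end

/-! ### The generators `k_α` and `s_α` -/

lemma mix_pos {α t : ℝ} (h0 : 0 < α) (h1 : α ≤ 1) (ht : 0 ≤ t) : 0 < α + (1 - α) * t := by
  have : 0 ≤ (1 - α) * t := mul_nonneg (by linarith) ht
  linarith

lemma kFun_eq (b α t : ℝ) : kFun b α t =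
    (t * Real.log t - t * Real.log (α + (1 - α) * t)) / Real.log b := by
  simp only [kFun, Real.logb]; ring

lemma sFun_eq (b α t : ℝ) : sFun b α t =
    (α * (t * Real.log t - t * Real.log (α + (1 - α) * t))
      + (1 - α) * -Real.log (α + (1 - α) * t)) / Real.log b := by
  simp only [sFun, Real.logb]; ring

lemma tendsto_klFun_zero (b : ℝ) : Tendsto (klFun b) (𝓝[>] 0) (𝓝 (klFun b 0)) := by
  have e : klFun b = fun t => t * Real.log t / Real.log b := by
    funext t; simp only [klFun, Real.logb]; ring
  have : Continuous (klFun b) := by rw [e]; exact Real.continuous_mul_log.div_const _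
  exact (this.tendsto 0).mono_left nhdsWithin_le_nhds

lemma continuousAt_log_mix {α : ℝ} (h0 : 0 < α) :
    ContinuousAt (fun t => Real.log (α + (1 - α) * t)) 0 :=
  ContinuousAt.log (by fun_prop) (by simpa using h0.ne')

lemma tendsto_kFun_zero (b : ℝ) {α : ℝ} (h0 : 0 < α) :
    Tendsto (kFun b α) (𝓝[>] 0) (𝓝 (kFun b α 0)) := by
  have : ContinuousAt (kFun b α) 0 := by
    rw [funext (kFun_eq b α)]
    exact (Real.continuous_mul_log.continuousAt.sub
      (continuousAt_id.mul (continuousAt_log_mix h0))).div_const _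
  exact this.tendsto.mono_left nhdsWithin_le_nhds

lemma tendsto_sFun_zero (b : ℝ) {α : ℝ} (h0 : 0 < α) :
    Tendsto (sFun b α) (𝓝[>] 0) (𝓝 (sFun b α 0)) := by
  have : ContinuousAt (sFun b α) 0 := by
    rw [funext (sFun_eq b α)]
    exact (((Real.continuous_mul_log.continuousAt.sub
      (continuousAt_id.mul (continuousAt_log_mix h0))).const_mul _).add
      ((continuousAt_log_mix h0).neg.const_mul _)).div_const _
  exact this.tendsto.mono_left nhdsWithin_le_nhds

lemma mul_log_sub_log_mix_isLittleO (α : ℝ) :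
    (fun x : ℝ => ((1 + x) * Real.log (1 + x) - (1 + x) * Real.log (α + (1 - α) * (1 + x)))
      - α * x - α ^ 2 / 2 * x ^ 2) =o[𝓝 0] fun x => x ^ 2 := by
  have hb : (fun x : ℝ => 1 + x) =O[𝓝 0] fun _ => (1 : ℝ) := by
    have : ContinuousAt (fun x : ℝ => 1 + x) 0 := by fun_prop
    exact this.tendsto.isBigO_one ℝ
  have h1 := hb.mul_isLittleO (log_one_add_isLittleO.sub (log_one_add_mul_isLittleO (1 - α)))
  -- The cubic term left when `1 + x` multiplies the quadratic parts of the two logarithms.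
  have h2 : (fun x : ℝ => (-(1 - (1 - α) ^ 2) / 2) * x ^ 3) =o[𝓝 0] fun x : ℝ => x ^ 2 :=
    (isLittleO_pow_pow (by norm_num)).const_mul_left _
  simp only [one_mul] at h1
  refine (h1.add h2).congr_left fun x => ?_
  rw [show α + (1 - α) * (1 + x) = 1 + (1 - α) * x by ring]
  ring

lemma kFun_isLittleO (b α : ℝ) :
    (fun x : ℝ => kFun b α (1 + x) - α / Real.log b * x - α ^ 2 / Real.log b / 2 * x ^ 2)
      =o[𝓝 0] fun x => x ^ 2 := by
  refine ((mul_log_sub_log_mix_isLittleO α).const_mul_left (Real.log b)⁻¹).congr_left fun x => ?_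
  rw [kFun_eq]
  ring

lemma sFun_isLittleO (b α : ℝ) :
    (fun x : ℝ => sFun b α (1 + x) - (α ^ 2 - (1 - α) ^ 2) / Real.log b * x
      - (1 - 3 * α + 3 * α ^ 2) / Real.log b / 2 * x ^ 2) =o[𝓝 0] fun x => x ^ 2 := by
  refine ((((mul_log_sub_log_mix_isLittleO α).const_mul_left α).sub
    ((log_one_add_mul_isLittleO (1 - α)).const_mul_left (1 - α))).const_mul_left
      (Real.log b)⁻¹).congr_left fun x => ?_
  rw [sFun_eq, show α + (1 - α) * (1 + x) = 1 + (1 - α) * x by ring]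
  ring

lemma kFun_le {b α t : ℝ} (hb : 1 < b) (h0 : 0 < α) (h1 : α ≤ 1) (ht : 0 ≤ t) :
    kFun b α t ≤ kFun b α 0 * (1 - t) + α / Real.log b * (t * (t - 1)) := by
  have hL : 0 < Real.log b := Real.log_pos hb
  have h := div_le_div_of_nonneg_right (mul_log_sub_log_mix_le h0 h1 ht) hL.le
  rw [kFun_eq, kFun_eq]
  refine h.trans_eq ?_
  simp
  ring

lemma sFun_le {b α t : ℝ} (hb : 1 < b) (h0 : 0 < α) (h1 : α ≤ 1) (ht : 0 ≤ t) :
    sFun b α t ≤ sFun b α 0 * (1 - t) +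
      ((1 - α) * Real.log (1 / α) + 2 * α - 1) / Real.log b * (t * (t - 1)) := by
  have hL : 0 < Real.log b := Real.log_pos hb
  have h := div_le_div_of_nonneg_right (add_le_add
    (mul_le_mul_of_nonneg_left (mul_log_sub_log_mix_le h0 h1 ht) h0.le)
    (mul_le_mul_of_nonneg_left (neg_log_mix_le h0 h1 ht) (sub_nonneg.2 h1))) hL.le
  rw [sFun_eq, sFun_eq]
  refine h.trans_eq ?_
  rw [one_div, Real.log_inv]
  simp
  ring

/-! ### The skew divergences as `f`-divergences -/

lemma mixture_pos {ι : Type*} {α : ℝ} {P Q : ι → ℝ} (h0 : 0 < α) (h1 : α ≤ 1)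
    (hP : ∀ x, 0 ≤ P x) (hQ : ∀ x, 0 < Q x) (x : ι) :
    0 < ((1 - α) • P + α • Q) x := by
  simp only [Pi.add_apply, Pi.smul_apply, smul_eq_mul]
  have := mul_nonneg (sub_nonneg.2 h1) (hP x)
  have := mul_pos h0 (hQ x)
  linarith

section

variable {b α : ℝ} {P Q : X → ℝ}

lemma realFDiv_klFun_eq {M : X → ℝ} (hM : ∀ x, 0 < M x) :
    realFDiv (klFun b) P M = (∑ x, P x * Real.log (P x / M x)) / Real.log b := by
  rw [realFDiv, sum_div]
  refine sum_congr rfl fun x _ => ?_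
  have := (hM x).ne'
  rw [klFun, Real.logb]
  field_simp

lemma kFun_term (h0 : 0 < α) (h1 : α ≤ 1) {p q : ℝ} (hp : 0 ≤ p) (hq : 0 < q) :
    ((1 - α) * p + α * q) * klFun b (p / ((1 - α) * p + α * q)) = q * kFun b α (p / q) := by
  rcases hp.eq_or_lt with rfl | hp
  · simp [klFun, kFun]
  have ht : 0 < p / q := by positivity
  have hm := mix_pos h0 h1 ht.le
  have e : (1 - α) * p + α * q = q * (α + (1 - α) * (p / q)) := by field_simp; ring
  have e2 : p / ((1 - α) * p + α * q) = (p / q) / (α + (1 - α) * (p / q)) := by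
    rw [e]; field_simp
  rw [e2, e, klFun, kFun, Real.logb_div ht.ne' hm.ne']
  generalize α + (1 - α) * (p / q) = M at hm
  field_simp

lemma sFun_term (h0 : 0 < α) (h1 : α ≤ 1) {p q : ℝ} (hp : 0 ≤ p) (hq : 0 < q) :
    α * (((1 - α) * p + α * q) * klFun b (p / ((1 - α) * p + α * q)))
      + (1 - α) * (((1 - α) * p + α * q) * klFun b (q / ((1 - α) * p + α * q)))
      = q * sFun b α (p / q) := by
  rw [kFun_term h0 h1 hp hq]
  have hm := mix_pos h0 h1 (div_nonneg hp hq.le)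
  have e : (1 - α) * p + α * q = q * (α + (1 - α) * (p / q)) := by field_simp; ring
  have e2 : q / ((1 - α) * p + α * q) = (α + (1 - α) * (p / q))⁻¹ := by
    rw [e]; field_simp
  rw [e2, e, klFun, kFun, sFun, Real.logb_inv]
  have e3 : ∀ l : ℝ, q * (α + (1 - α) * (p / q)) * ((α + (1 - α) * (p / q))⁻¹ * -l) = -(q * l) :=
    fun l => by rw [← mul_assoc, mul_assoc q, mul_inv_cancel₀ hm.ne']; ring
  rw [e3]
  ring

lemma realFDiv_kFun_eq (h0 : 0 < α) (h1 : α ≤ 1) (hP : ∀ x, 0 ≤ P x) (hQ : ∀ x, 0 < Q x) :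
    realFDiv (klFun b) P ((1 - α) • P + α • Q) = realFDiv (kFun b α) P Q :=
  sum_congr rfl fun x _ => kFun_term h0 h1 (hP x) (hQ x)

lemma realFDiv_sFun_eq (h0 : 0 < α) (h1 : α ≤ 1) (hP : ∀ x, 0 ≤ P x) (hQ : ∀ x, 0 < Q x) :
    α * realFDiv (klFun b) P ((1 - α) • P + α • Q)
      + (1 - α) * realFDiv (klFun b) Q ((1 - α) • P + α • Q) = realFDiv (sFun b α) P Q := by
  rw [realFDiv, realFDiv, mul_sum, mul_sum, ← sum_add_distrib]
  exact sum_congr rfl fun x _ => sFun_term h0 h1 (hP x) (hQ x)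

lemma skewK_eq_coe (h0 : 0 < α) (h1 : α ≤ 1) (hP : ∀ x, 0 ≤ P x) (hQ : ∀ x, 0 < Q x) :
    skewK b α P Q = (realFDiv (kFun b α) P Q : EReal) := by
  rw [skewK, relEntropy, fDiv_eq_coe (tendsto_klFun_zero b) hP (mixture_pos h0 h1 hP hQ),
    realFDiv_kFun_eq h0 h1 hP hQ]

lemma skewS_eq_coe (h0 : 0 < α) (h1 : α ≤ 1) (hP : ∀ x, 0 ≤ P x) (hQ : ∀ x, 0 < Q x) :
    skewS b α P Q = (realFDiv (sFun b α) P Q : EReal) := by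
  have hM := mixture_pos h0 h1 hP hQ
  rw [skewS, relEntropy, relEntropy, fDiv_eq_coe (tendsto_klFun_zero b) hP hM,
    fDiv_eq_coe (tendsto_klFun_zero b) (fun x => (hQ x).le) hM, ← realFDiv_sFun_eq h0 h1 hP hQ,
    EReal.coe_add, EReal.coe_mul, EReal.coe_mul]

/-- Pinsker's inequality combined with the comparison of the `ℓ¹` and chi-squared distances. -/
lemma chiSq_le_klFun [DecidableEq X] (hb : 1 < b) {m : ℝ} (hm : 0 < m) (hmQ : ∀ x, m ≤ Q x)
    (hP : P ∈ stdSimplex ℝ X) (hQ : Q ∈ stdSimplex ℝ X) {p M : X → ℝ} (hp : p ∈ stdSimplex ℝ X)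
    (hM : M ∈ stdSimplex ℝ X) (hM0 : ∀ x, 0 < M x) {c : ℝ}
    (hc : ∀ x, |p x - M x| = c * |P x - Q x|) :
    c ^ 2 / Real.log b * m * realFDiv chiSqFun P Q ≤ realFDiv (klFun b) p M := by
  have hL : 0 < Real.log b := Real.log_pos hb
  have h1 := pinsker hp hM hM0
  have h2 := two_mul_sq_sum_div_le (v := fun x => P x - Q x) hm hmQ
    (by rw [sum_sub_distrib, hP.2, hQ.2, sub_self])
  rw [sum_congr rfl fun x _ => hc x, ← mul_sum, mul_pow] at h1
  rw [realFDiv_klFun_eq hM0, realFDiv_chiSq fun x => hm.trans_le (hmQ x), div_mul_eq_mul_div,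
    div_mul_eq_mul_div]
  gcongr
  have h3 := mul_le_mul_of_nonneg_left h2 (sq_nonneg c)
  linarith

variable [DecidableEq X]

lemma chiSq_le_kFun (hb : 1 < b) (h0 : 0 < α) (h1 : α ≤ 1) {m : ℝ} (hm : 0 < m)
    (hmQ : ∀ x, m ≤ Q x) (hP : P ∈ stdSimplex ℝ X) (hQ : Q ∈ stdSimplex ℝ X) :
    α ^ 2 / Real.log b * m * realFDiv chiSqFun P Q ≤ realFDiv (kFun b α) P Q := by
  have hQ0 : ∀ x, 0 < Q x := fun x => hm.trans_le (hmQ x)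
  rw [← realFDiv_kFun_eq h0 h1 hP.1 hQ0]
  refine chiSq_le_klFun hb hm hmQ hP hQ hP
    (convex_stdSimplex ℝ X hP hQ (sub_nonneg.2 h1) h0.le (by ring))
    (mixture_pos h0 h1 hP.1 hQ0) fun x => ?_
  rw [← abs_of_pos h0, ← abs_mul, abs_of_pos h0]
  simp only [Pi.add_apply, Pi.smul_apply, smul_eq_mul]
  ring_nf

lemma chiSq_le_sFun (hb : 1 < b) (h0 : 0 < α) (h1 : α ≤ 1) {m : ℝ} (hm : 0 < m)
    (hmQ : ∀ x, m ≤ Q x) (hP : P ∈ stdSimplex ℝ X) (hQ : Q ∈ stdSimplex ℝ X) :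
    (1 - 3 * α + 3 * α ^ 2) / Real.log b * m * realFDiv chiSqFun P Q
      ≤ realFDiv (sFun b α) P Q := by
  have hQ0 : ∀ x, 0 < Q x := fun x => hm.trans_le (hmQ x)
  have k1 := chiSq_le_kFun (b := b) hb h0 h1 hm hmQ hP hQ
  have k2 : (1 - α) ^ 2 / Real.log b * m * realFDiv chiSqFun P Q
      ≤ realFDiv (klFun b) Q ((1 - α) • P + α • Q) := by
    refine chiSq_le_klFun hb hm hmQ hP hQ hQ
      (convex_stdSimplex ℝ X hP hQ (sub_nonneg.2 h1) h0.le (by ring))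
      (mixture_pos h0 h1 hP.1 hQ0) fun x => ?_
    rw [abs_sub_comm (P x), ← abs_of_nonneg (sub_nonneg.2 h1), ← abs_mul,
      abs_of_nonneg (sub_nonneg.2 h1)]
    simp only [Pi.add_apply, Pi.smul_apply, smul_eq_mul]
    ring_nf
  rw [← realFDiv_sFun_eq h0 h1 hP.1 hQ0, realFDiv_kFun_eq h0 h1 hP.1 hQ0]
  -- The constants add up as `α · α² + (1 - α) · (1 - α)² = 1 - 3α + 3α²`, which matches the
  -- second-order coefficient of `s_α`.
  refine le_trans (le_of_eq ?_) (add_le_add (mul_le_mul_of_nonneg_left k1 h0.le)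
    (mul_le_mul_of_nonneg_left k2 (sub_nonneg.2 h1)))
  ring

lemma kFun_chiSqComparable (hb : 1 < b) (h0 : 0 < α) (h1 : α ≤ 1) {m : ℝ} (hm : 0 < m)
    (hmQ : ∀ x, m ≤ Q x) (hQ : Q ∈ stdSimplex ℝ X) :
    ChiSqComparable (kFun b α) Q (α ^ 2 / Real.log b) m (α / Real.log b) where
  tendsto_zero := tendsto_kFun_zero b h0
  k_pos := div_pos (by positivity) (Real.log_pos hb)
  m_pos := hm
  le_chiSq _ hP := realFDiv_le_of_pointwise (fun _ ht => kFun_le hb h0 h1 ht) hP hQ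
    fun x => hm.trans_le (hmQ x)
  chiSq_le _ hP := chiSq_le_kFun hb h0 h1 hm hmQ hP hQ
  expansion := ⟨_, kFun_isLittleO b α⟩

lemma one_sub_three_mul_add_pos (α : ℝ) : 0 < 1 - 3 * α + 3 * α ^ 2 := by
  nlinarith [sq_nonneg (2 * α - 1)]

lemma sFun_chiSqComparable (hb : 1 < b) (h0 : 0 < α) (h1 : α ≤ 1) {m : ℝ} (hm : 0 < m)
    (hmQ : ∀ x, m ≤ Q x) (hQ : Q ∈ stdSimplex ℝ X) :
    ChiSqComparable (sFun b α) Q ((1 - 3 * α + 3 * α ^ 2) / Real.log b) m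
      (((1 - α) * Real.log (1 / α) + 2 * α - 1) / Real.log b) where
  tendsto_zero := tendsto_sFun_zero b h0
  k_pos := div_pos (one_sub_three_mul_add_pos α) (Real.log_pos hb)
  m_pos := hm
  le_chiSq _ hP := realFDiv_le_of_pointwise (fun _ ht => sFun_le hb h0 h1 ht) hP hQ
    fun x => hm.trans_le (hmQ x)
  chiSq_le _ hP := chiSq_le_sFun hb h0 h1 hm hmQ hP hQ
  expansion := ⟨_, sFun_isLittleO b α⟩

end

end SkewDivergence

open SkewDivergence in
theorem mainTheorem11 {X : Type*} [Fintype X] [DecidableEq X] [Nontrivial X]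
    (b : ℝ) (hb : 1 < b)
    (W : Matrix X X ℝ) (hW : W ∈ Matrix.rowStochastic ℝ X) (hirr : W.IsIrreducible)
    (Q : X → ℝ) (hQ : Q ∈ stdSimplex ℝ X) (hstat : Q ᵥ* W = Q)
    (hrev : ∀ x y, Q x * W x y = Q y * W y x)
    (α : ℝ) (hα0 : 0 < α) (hα1 : α ≤ 1) (n : ℕ) :
    (∀ P ∈ stdSimplex ℝ X,
      skewK b α (P ᵥ* W ^ n) Q ≤ contractionCoeff (kFun b α) Q (W ^ n) * skewK b α P Q ∧
      skewS b α (P ᵥ* W ^ n) Q ≤ contractionCoeff (sFun b α) Q (W ^ n) * skewS b α P Q) ∧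
    (contractionCoeff chiSqFun Q W ^ n ≤ contractionCoeff (kFun b α) Q (W ^ n) ∧
      contractionCoeff (kFun b α) Q (W ^ n) ≤
        ((1 / (α * minMass Q) : ℝ) : EReal) * contractionCoeff chiSqFun Q W ^ n) ∧
    (contractionCoeff chiSqFun Q W ^ n ≤ contractionCoeff (sFun b α) Q (W ^ n) ∧
      contractionCoeff (sFun b α) Q (W ^ n) ≤
        ((((1 - α) * Real.log (1 / α) + 2 * α - 1) /
            ((1 - 3 * α + 3 * α ^ 2) * minMass Q) : ℝ) : EReal) *
          contractionCoeff chiSqFun Q W ^ n) := by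
  have hQ0 : ∀ x, 0 < Q x := pos_of_isIrreducible hirr hQ hstat
  obtain ⟨hm, hmQ⟩ := minMass_pos_and_le hQ0
  have hL : Real.log b ≠ 0 := (Real.log_pos hb).ne'
  have hQn := vecMul_pow_eq_self hstat n
  have hWn : W ^ n ∈ rowStochastic ℝ X := pow_mem hW n
  obtain ⟨μ, hμ, -⟩ := exists_coe_contractionCoeff_chiSq hQ0 hQn hWn
  obtain ⟨κ, hκ, hκ1, hκ2, hκ3⟩ := exists_coe_contractionCoeff_comparable
    (kFun_chiSqComparable hb hα0 hα1 hm hmQ hQ) hQ hQ0 hQn hWn hμ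
  obtain ⟨σ, hσ, hσ1, hσ2, hσ3⟩ := exists_coe_contractionCoeff_comparable
    (sFun_chiSqComparable hb hα0 hα1 hm hmQ hQ) hQ hQ0 hQn hWn hμ
  -- The base of the logarithm cancels in `C / (k m)`.
  have hκc : α / Real.log b / (α ^ 2 / Real.log b * minMass Q) = 1 / (α * minMass Q) := by
    field_simp
  have hσc : ((1 - α) * Real.log (1 / α) + 2 * α - 1) / Real.log b /
      ((1 - 3 * α + 3 * α ^ 2) / Real.log b * minMass Q) =
      ((1 - α) * Real.log (1 / α) + 2 * α - 1) / ((1 - 3 * α + 3 * α ^ 2) * minMass Q) := by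
    have := (one_sub_three_mul_add_pos α).ne'
    rw [div_div, ← mul_assoc, mul_div_cancel₀ _ hL]
  rw [hκc] at hκ2
  rw [hσc] at hσ2
  rw [← contractionCoeff_chiSq_pow hQ0 hstat hW hrev n, hμ, hκ, hσ]
  refine ⟨fun P hP => ?_, ?_, ?_⟩
  · have hPn := vecMul_mem_stdSimplex hWn hP
    rw [skewK_eq_coe hα0 hα1 hPn.1 hQ0, skewK_eq_coe hα0 hα1 hP.1 hQ0,
      skewS_eq_coe hα0 hα1 hPn.1 hQ0, skewS_eq_coe hα0 hα1 hP.1 hQ0]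
    exact_mod_cast And.intro (hκ3 P hP) (hσ3 P hP)
  · rw [← EReal.coe_mul, EReal.coe_le_coe_iff, EReal.coe_le_coe_iff]
    exact ⟨hκ1, hκ2⟩
  · rw [← EReal.coe_mul, EReal.coe_le_coe_iff, EReal.coe_le_coe_iff]
    exact ⟨hσ1, hσ2⟩
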